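/- Let $n\ge 1$. Cubes in $\mathbb{R}^n$ have sides parallel to the axes, $bQ$ is the cube with the centre of $Q$ and $b$ times its side length, and $1/q'=1-1/q$. Let $1\le q\le\infty$ and $1<r\le\infty$ with $r\ge q'$. Let $T$ be a Calderón–Zygmund operator whose kernel $K$ satisfies the $L^q$-Hörmander condition. That is, $T$ is a linear operator on $L^1(\mathbb{R}^n)$ of weak type $(1,1)$, with $Tf$ an everywhere defined function and linearity holding at every point; $K(x,\cdot)$ is locally integrable on $\mathbb{R}^n\setminus\{x\}$ for every $x$; for every bounded $f$ with compact support, $$Tf(x)=\int_{\mathbb{R}^n}K(x,y)f(y)\,dy\qquad\text{for every } x\notin\operatorname{supp} f;$$ and $$\sup_Q\ \sup_{x',x''\in\frac12 Q}\ \sum_{k=1}^\infty |2^kQ|^{1/q'}\,\|K(x',\cdot)-K(x'',\cdot)\|_{L^q(2^kQ\setminus 2^{k-1}Q)}<\infty .$$ Let $\mathcal{F}=\{\phi_\alpha\}_{\alpha\in A}$ be a family of real-valued measurable functions on $\mathbb{R}^n$, and put $\mathcal{M}^{\phi}f(x)=e^{2\pi i\phi(x)}f(x)$, $$T^{\mathcal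 F}f(x)=\sup_{\alpha\in A}|T(\mathcal{M}^{\phi_\alpha}f)(x)|,\qquad T^{\mathcal F}_*f(x)=\sup_{\varepsilon>0}\ \sup_{\alpha\in A}\Big|\int_{|x-y|>\varepsilon}K(x,y)\,\mathcal{M}^{\phi_\alpha}f(y)\,dy\Big| .$$ Assume that there are a constant $C$ and a non-decreasing function $\psi:[1,\infty)\to[0,\infty)$ such that, for all $1<p\le2$ and all compactly supported $f\in L^p(\mathbb{R}^n)$, $$\|T^{\mathcal F}f\|_{L^{p,\infty}}\le C\,\psi(p')\,\|f\|_{L^p}.$$ Let $M_rf(x)=\sup_{Q\ni x}\big(\frac1{|Q|}\int_Q|f|^r\big)^{1/r}$, the supremum being over all cubes containing $x$ (for $r=\infty$ the average is the essential supremum of $|f|$ over $Q$). Then there are constants $a,c>0$, which do not depend on $Q$, $f$ and $t$, such that for every cube $Q$, every $f\in L^\infty(\mathbb{R}^n)$ with $\operatorname{supp} f\subseteq Q$ and every $t>0$, $$|\{x\in Q: T^{\mathcal F}_*f(x)>t\,M_rf(x)\}|\le c\,e^{-at}\,|Q| .$$ (If the set is not measurable, $|\cdot|$ denotes Lebesgue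 outer measure.) -/

import Mathlib

open MeasureTheory Set
open scoped ENNReal NNReal

namespace ModulatedCZ

/-- The space `ℝⁿ` with its Euclidean norm. -/
abbrev E (n : ℕ) : Type := EuclideanSpace ℝ (Fin n)

/-- The closed cube in `ℝⁿ` with centre `z`, side length `s` and sides parallel to the axes. Its
dilate by the factor `b` about its centre is `cube z (b * s)`. -/
def cube {n : ℕ} (z : E n) (s : ℝ) : Set (E n) := {y | ∀ i, |y i - z i| ≤ s / 2}

/-- The average `⟨f⟩_{r, Q} = (|Q|⁻¹ ∫_Q |f|^r)^{1/r}` for `1 ≤ r < ∞`; for `r = ∞` it is the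
essential supremum of `|f|` over `Q`. -/
noncomputable def average {n : ℕ} (r : ℝ≥0∞) (f : E n → ℂ) (Q : Set (E n)) : ℝ≥0∞ :=
  (volume Q) ^ (-(r⁻¹).toReal) * eLpNorm f r (volume.restrict Q)

/-- The maximal function `M_r f (x) = sup_{Q ∋ x} ⟨f⟩_{r, Q}`, over all cubes containing `x`. -/
noncomputable def maximalFunction {n : ℕ} (r : ℝ≥0∞) (f : E n → ℂ) (x : E n) : ℝ≥0∞ :=
  ⨆ (z : E n) (s : ℝ) (_ : 0 < s) (_ : x ∈ cube z s), average r f (cube z s)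

/-- The weak `L^p` quasinorm `sup_{u > 0} u |{g > u}|^{1/p}` of a nonnegative function. -/
noncomputable def weakNorm {n : ℕ} (p : ℝ) (g : E n → ℝ≥0∞) : ℝ≥0∞ :=
  ⨆ u : ℝ≥0, (u : ℝ≥0∞) * (volume {x | (u : ℝ≥0∞) < g x}) ^ (1 / p)

/-- The `L^q`-Hörmander constant of a kernel: the supremum over all cubes `Q` and all
`x', x'' ∈ (1/2) Q` of
`∑_{k ≥ 1} |2^k Q|^{1/q'} ‖K(x', ·) - K(x'', ·)‖_{L^q(2^k Q \ 2^(k-1) Q)}`,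
where `1/q' = 1 - 1/q`. -/
noncomputable def hormanderConst {n : ℕ} (q : ℝ≥0∞) (K : E n → E n → ℂ) : ℝ≥0∞ :=
  ⨆ (z : E n) (s : ℝ) (_ : 0 < s) (x' ∈ cube z (s / 2)) (x'' ∈ cube z (s / 2)),
    ∑' k : ℕ, (volume (cube z (2 ^ (k + 1) * s))) ^ (1 - q⁻¹).toReal *
      eLpNorm (fun y => K x' y - K x'' y) q
        (volume.restrict (cube z (2 ^ (k + 1) * s) \ cube z (2 ^ k * s)))

/-- `T` is a Calderón–Zygmund operator with kernel `K` satisfying the `L^q`-Hörmander condition: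
`T` is linear on `L¹(ℝⁿ)`, of weak type `(1, 1)`, and `T f (x) = ∫ K(x, y) f(y) dy` for
`x ∉ supp f`. As `K(x, ·)` is only locally integrable off `x`, the representation is required of
bounded compactly supported `f`, for which the integral converges absolutely. The values of `T`
on functions that are not integrable are irrelevant. -/
structure IsCalderonZygmund {n : ℕ} (q : ℝ≥0∞) (T : (E n → ℂ) → E n → ℂ)
    (K : E n → E n → ℂ) : Prop where
  map_add : ∀ f g : E n → ℂ, Integrable f volume → Integrable g volume → T (f + g) = T f + T g
  map_smul : ∀ (b : ℂ) (f : E n → ℂ), Integrable f volume → T (b • f) = b • T f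
  aestronglyMeasurable : ∀ f : E n → ℂ, Integrable f volume → AEStronglyMeasurable (T f) volume
  weak_type : ∃ C : ℝ≥0, ∀ f : E n → ℂ, Integrable f volume →
    weakNorm 1 (fun x => ‖T f x‖ₑ) ≤ C * eLpNorm f 1 volume
  locallyIntegrableOn_kernel : ∀ x, LocallyIntegrableOn (K x) {x}ᶜ volume
  representation : ∀ f : E n → ℂ, MemLp f ∞ volume → HasCompactSupport f →
    ∀ x, x ∉ tsupport f → T f x = ∫ y, K x y * f y
  hormander : hormanderConst q K < ∞

/-- The modulation `x ↦ e^{2 π i φ(x)} f(x)`. -/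
noncomputable def modulate {n : ℕ} (φ : E n → ℝ) (f : E n → ℂ) (x : E n) : ℂ :=
  Complex.exp (2 * Real.pi * Complex.I * (φ x : ℂ)) * f x

/-- The maximally modulated operator `T^F f (x) = sup_α |T (e^{2 π i φ_α} f) (x)|`. -/
noncomputable def maxModulated {n : ℕ} {A : Type*} (T : (E n → ℂ) → E n → ℂ) (φ : A → E n → ℝ)
    (f : E n → ℂ) (x : E n) : ℝ≥0∞ :=
  ⨆ α : A, ‖T (modulate (φ α) f) x‖ₑ

/-- The truncated operator `T_ε f (x) = ∫_{|x - y| > ε} K(x, y) f(y) dy`. -/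
noncomputable def truncated {n : ℕ} (K : E n → E n → ℂ) (ε : ℝ) (f : E n → ℂ) (x : E n) : ℂ :=
  ∫ y in {y : E n | ε < ‖x - y‖}, K x y * f y

/-- The maximally modulated maximal singular integral
`T^F_* f (x) = sup_{ε > 0} sup_α |T_ε (e^{2 π i φ_α} f) (x)|`. -/
noncomputable def maxModulatedMaximal {n : ℕ} {A : Type*} (K : E n → E n → ℂ)
    (φ : A → E n → ℝ) (f : E n → ℂ) (x : E n) : ℝ≥0∞ :=
  ⨆ (ε : ℝ) (_ : 0 < ε) (α : A), ‖truncated K ε (modulate (φ α) f) x‖ₑ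

/-- The a priori assumption `‖T^F f‖_{L^{p,∞}} ≤ C ψ(p') ‖f‖_{L^p}` for all `1 < p ≤ 2`, where
`p' = p / (p - 1)`, `ψ` is nondecreasing on `[1, ∞)` and `C` is independent of `p` and `f`, for all
compactly supported `f ∈ L¹`. The bound is empty if `‖f‖_{L^p} = ∞`, and compactly supported
functions in `L^p` are integrable, so it is required of compactly supported `f ∈ L^p`. -/
def APrioriBound {n : ℕ} {A : Type*} (T : (E n → ℂ) → E n → ℂ) (φ : A → E n → ℝ)
    (ψ : ℝ → ℝ≥0) : Prop :=
  MonotoneOn ψ (Ici 1) ∧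
    ∃ C : ℝ≥0, ∀ p : ℝ, 1 < p → p ≤ 2 → ∀ f : E n → ℂ,
      MemLp f (ENNReal.ofReal p) volume → HasCompactSupport f →
        weakNorm p (maxModulated T φ f) ≤
          C * ψ (p / (p - 1)) * eLpNorm f (ENNReal.ofReal p) volume

end ModulatedCZ

namespace ModulatedCZ

open Metric

variable {n : ℕ}

/-! The a priori bound enters at the single exponent `p = min(r, 2)`, where it is a weak `(p, p)`
bound for `T^F`. A function `g` supported in `3B` then has `T^F g ≤ b` off a set `Ω` of measure at
most `θ|B|`, and `b` is at most a constant times `M_r g` everywhere on `B`.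

A local Cotlar inequality (`exists_maxModulatedMaximal_le`) passes to `T^F_*`: the far part of a
truncation at `x` is compared, by the Hörmander condition, with its value at a nearby `x' ∉ Ω`.
Where `Ω` has small density at every scale, this gives `T^F_* g ≤ C M_r g`. The remaining points are
covered by Vitali balls `5B_a` of total measure at most `|B|/2`. On `5B_a`, up to `C M_r g`, only
`g` restricted to `15B_a = 3(5B_a)` matters, so the situation reproduces itself.

Since `M_r` decreases under restriction, `k` iterations give `|{x ∈ B : T^F_* g > k C M_r g}| ≤
2^{-k}|B|`, which is exponential decay in `t` with `k ≈ t / C`. -/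

/-! ### Balls, cubes and superlevel sets -/

theorem closedBall_subset_cube (z : E n) (R : ℝ) : closedBall z R ⊆ cube z (2 * R) := by
  intro y hy i
  have h := PiLp.norm_apply_le (y - z) i
  rw [mem_closedBall, dist_eq_norm] at hy
  simp only [PiLp.sub_apply, Real.norm_eq_abs] at h
  linarith

theorem cube_subset_closedBall (z : E n) {s : ℝ} (hs : 0 ≤ s) :
    cube z s ⊆ closedBall z (n * s / 2) := by
  intro y hy
  rw [mem_closedBall, dist_eq_norm, EuclideanSpace.norm_eq]
  apply Real.sqrt_le_iff.2 ⟨by positivity, ?_⟩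
  have h : ∀ i, ‖(y - z) i‖ ^ 2 ≤ (s / 2) ^ 2 := fun i => by
    have := hy i
    simp only [PiLp.sub_apply, Real.norm_eq_abs]
    gcongr
  refine (Finset.sum_le_sum fun i _ => h i).trans ?_
  simp only [Finset.sum_const, Finset.card_univ, Fintype.card_fin, nsmul_eq_mul]
  have hn : (n : ℝ) ≤ (n : ℝ) ^ 2 := by exact_mod_cast Nat.le_self_pow two_ne_zero n
  calc (n : ℝ) * (s / 2) ^ 2 ≤ (n : ℝ) ^ 2 * (s / 2) ^ 2 := by gcongr
    _ = (n * s / 2) ^ 2 := by ring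

theorem volume_closedBall_mul (x y : E n) {b R : ℝ} (hb : 0 ≤ b) (hR : 0 ≤ R) :
    volume (closedBall x (b * R)) = ENNReal.ofReal (b ^ n) * volume (closedBall y R) := by
  rw [Measure.addHaar_closedBall_mul volume x hb hR, Measure.addHaar_closedBall_center volume y]
  simp

theorem volume_closedBall_ne_zero (x : E n) {R : ℝ} (hR : 0 < R) : volume (closedBall x R) ≠ 0 :=
  (measure_closedBall_pos volume x hR).ne'

theorem volume_closedBall_ne_top (x : E n) (R : ℝ) : volume (closedBall x R) ≠ ∞ :=
  measure_closedBall_lt_top.ne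

theorem volume_cube_ne_zero (z : E n) {s : ℝ} (hs : 0 < s) : volume (cube z s) ≠ 0 := by
  have h := closedBall_subset_cube z (s / 2)
  rw [mul_div_cancel₀ s two_ne_zero] at h
  exact fun h0 => volume_closedBall_ne_zero z (half_pos hs) (measure_mono_null h h0)

theorem volume_cube_ne_top (z : E n) {s : ℝ} (hs : 0 ≤ s) : volume (cube z s) ≠ ∞ :=
  ((measure_mono (cube_subset_closedBall z hs)).trans_lt measure_closedBall_lt_top).ne

theorem volume_cube_le (z x : E n) {b R : ℝ} (hb : 0 ≤ b) (hR : 0 ≤ R) :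
    volume (cube z (b * R)) ≤ ENNReal.ofReal ((n * b / 2) ^ n) * volume (closedBall x R) := by
  rw [← volume_closedBall_mul z x (by positivity) hR]
  rw [show n * b / 2 * R = n * (b * R) / 2 by ring]
  exact measure_mono (cube_subset_closedBall z (mul_nonneg hb hR))

/-- A superlevel set bound that follows from a weak-type estimate. -/
theorem volume_superlevel_le {p : ℝ} (hp : 0 < p) {F : E n → ℝ≥0∞} {W : ℝ≥0∞}
    (hF : weakNorm p F ≤ W) (hW : W ≠ ∞) {m : ℝ≥0∞} (hm : m ≠ 0) (hm' : m ≠ ∞) :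
    volume {x | m ^ (-(1 / p)) * W < F x} ≤ m := by
  have key : ∀ u : ℝ≥0, (u : ℝ≥0∞) * (volume {x | (u : ℝ≥0∞) < F x}) ^ (1 / p) ≤ W :=
    fun u => (le_iSup (fun u : ℝ≥0 =>
      (u : ℝ≥0∞) * (volume {x | (u : ℝ≥0∞) < F x}) ^ (1 / p)) u).trans hF
  have hp' : 0 < 1 / p := by positivity
  have hmp : m ^ (-(1 / p)) ≠ ∞ := ENNReal.rpow_ne_top_of_ne_zero hm hm'
  -- For `W = 0` the level is `0`, where the quasinorm carries no information; the set is exhausted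
  -- by the levels `1 / (k + 1)`.
  rcases eq_or_ne W 0 with rfl | hW0
  · have hsub : {x | m ^ (-(1 / p)) * 0 < F x} ⊆
        ⋃ k : ℕ, {x | (((1 : ℝ≥0) / (k + 1) : ℝ≥0) : ℝ≥0∞) < F x} := by
      intro x hx
      simp only [mul_zero, mem_ofPred_eq] at hx
      obtain ⟨v, hv0, hv⟩ := ENNReal.lt_iff_exists_nnreal_btwn.1 hx
      obtain ⟨k, hk⟩ := exists_nat_one_div_lt (ENNReal.coe_pos.1 hv0)
      exact mem_iUnion.2 ⟨k, (ENNReal.coe_lt_coe.2 hk).trans hv⟩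
    have hzero : ∀ k : ℕ, volume {x | (((1 : ℝ≥0) / (k + 1) : ℝ≥0) : ℝ≥0∞) < F x} = 0 := by
      intro k
      have h := key ((1 : ℝ≥0) / (k + 1))
      rw [nonpos_iff_eq_zero, mul_eq_zero] at h
      rcases h with h | h
      · exact absurd (ENNReal.coe_eq_zero.1 h) (by positivity)
      · exact ((ENNReal.rpow_eq_zero_iff_of_pos hp').1 h)
    exact (measure_mono_null hsub (measure_iUnion_null hzero)).le.trans zero_le
  · have hu : ((m ^ (-(1 / p)) * W).toNNReal : ℝ≥0∞) = m ^ (-(1 / p)) * W :=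
      ENNReal.coe_toNNReal (ENNReal.mul_ne_top hmp hW)
    have h := key (m ^ (-(1 / p)) * W).toNNReal
    rw [hu] at h
    have h1 : (volume {x | m ^ (-(1 / p)) * W < F x}) ^ (1 / p) ≤ m ^ (1 / p) := by
      have h2 : W * (m ^ (-(1 / p)) * (volume {x | m ^ (-(1 / p)) * W < F x}) ^ (1 / p)) ≤ W * 1 := by
        rw [mul_one, ← mul_assoc, mul_comm W]
        exact h
      have h3 := (ENNReal.mul_le_mul_iff_right hW0 hW).1 h2
      rw [ENNReal.rpow_neg] at h3 ⊢
      rw [mul_comm, ← div_eq_mul_inv] at h3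
      have h4 := (ENNReal.div_le_iff (ENNReal.rpow_pos hm.bot_lt hm').ne'
        (ENNReal.rpow_ne_top_of_nonneg hp'.le hm')).1 h3
      rwa [one_mul] at h4
    exact (ENNReal.rpow_le_rpow_iff hp').1 h1

/-! ### Maximal function, modulations and supports -/

theorem average_le_maximalFunction (r : ℝ≥0∞) (f : E n → ℂ) {z x : E n} {s : ℝ} (hs : 0 < s)
    (hx : x ∈ cube z s) : average r f (cube z s) ≤ maximalFunction r f x :=
  le_iSup₂_of_le z s <| le_iSup₂_of_le hs hx le_rfl

/-- Hölder on a set of finite measure raises the exponent from `p` to `r`; the average is then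
bounded by `M_r f` at any point of the cube. -/
theorem eLpNorm_restrict_cube_le {p r : ℝ≥0∞} (hpr : p ≤ r) {f : E n → ℂ}
    (hf : AEStronglyMeasurable f volume) {z x : E n} {s : ℝ} (hs : 0 < s) (hx : x ∈ cube z s) :
    eLpNorm f p (volume.restrict (cube z s)) ≤
      volume (cube z s) ^ (p⁻¹).toReal * maximalFunction r f x := by
  have h0 := volume_cube_ne_zero z hs
  have h1 := volume_cube_ne_top z hs.le
  have h2 : eLpNorm f r (volume.restrict (cube z s)) =
      volume (cube z s) ^ (r⁻¹).toReal * average r f (cube z s) := by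
    rw [average, ← mul_assoc, ← ENNReal.rpow_add _ _ h0 h1, add_neg_cancel, ENNReal.rpow_zero,
      one_mul]
  calc eLpNorm f p (volume.restrict (cube z s))
      ≤ eLpNorm f r (volume.restrict (cube z s)) *
        (volume.restrict (cube z s)) univ ^ (1 / p.toReal - 1 / r.toReal) :=
        eLpNorm_le_eLpNorm_mul_rpow_measure_univ hpr hf.restrict
    _ = volume (cube z s) ^ (p⁻¹).toReal * average r f (cube z s) := by
        rw [h2, Measure.restrict_apply_univ, mul_right_comm, ← ENNReal.rpow_add _ _ h0 h1]
        congr 2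
        simp only [ENNReal.toReal_inv, one_div]
        ring
    _ ≤ _ := by gcongr; exact average_le_maximalFunction r f hs hx

theorem maximalFunction_mono (r : ℝ≥0∞) {f g : E n → ℂ} (hfg : ∀ y, ‖f y‖ ≤ ‖g y‖) (x : E n) :
    maximalFunction r f x ≤ maximalFunction r g x := by
  unfold maximalFunction average
  gcongr with z s hs hx
  exact eLpNorm_mono hfg

theorem norm_modulate (φ : E n → ℝ) (f : E n → ℂ) (x : E n) : ‖modulate φ f x‖ = ‖f x‖ := by
  have h : (2 * Real.pi * Complex.I * (φ x : ℂ)) = ((2 * Real.pi * φ x : ℝ) : ℂ) * Complex.I := by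
    push_cast
    ring
  rw [modulate, norm_mul, h, Complex.norm_exp_ofReal_mul_I, one_mul]

theorem modulate_indicator (φ : E n → ℝ) (f : E n → ℂ) (G : Set (E n)) :
    modulate φ (G.indicator f) = G.indicator (modulate φ f) := by
  ext x
  by_cases hx : x ∈ G <;> simp [modulate, hx]

theorem measurable_modulation {φ : E n → ℝ} (hφ : Measurable φ) :
    Measurable fun x => Complex.exp (2 * Real.pi * Complex.I * (φ x : ℂ)) := by
  fun_prop

theorem memLp_modulate {φ : E n → ℝ} (hφ : Measurable φ) {p : ℝ≥0∞} {f : E n → ℂ}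
    (hf : MemLp f p volume) : MemLp (modulate φ f) p volume :=
  hf.of_le ((measurable_modulation hφ).aestronglyMeasurable.mul hf.1)
    (ae_of_all _ fun x => (norm_modulate φ f x).le)

theorem tsupport_modulate_subset (φ : E n → ℝ) (f : E n → ℂ) :
    tsupport (modulate φ f) ⊆ tsupport f :=
  closure_mono fun x hx h => hx (by simp [modulate, h])

/-- A bounded function with compact support belongs to every `L^p`. -/
theorem memLp_of_hasCompactSupport {p : ℝ≥0∞} {f : E n → ℂ} (hf : MemLp f ∞ volume)
    (hc : HasCompactSupport f) : MemLp f p volume := by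
  have h := hf.mono_exponent_of_measure_support_ne_top (p := p) (s := tsupport f)
    (fun x hx => image_eq_zero_of_notMem_tsupport hx) hc.measure_ne_top le_top
  exact h

theorem hasCompactSupport_indicator {f : E n → ℂ} (hc : HasCompactSupport f) (G : Set (E n)) :
    HasCompactSupport (G.indicator f) :=
  hc.mono fun x hx h => hx (by simp [h])

theorem cube_mono (z : E n) {s t : ℝ} (hst : s ≤ t) : cube z s ⊆ cube z t :=
  fun _ hy i => (hy i).trans (by linarith)

/-! ### The Hörmander condition on dyadic shells -/

theorem compl_cube_subset_iUnion (x : E n) {s : ℝ} (hs : 0 < s) :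
    (cube x s)ᶜ ⊆ ⋃ k : ℕ, cube x (2 ^ (k + 1) * s) \ cube x (2 ^ k * s) := by
  classical
  intro u hu
  have hex : ∃ k : ℕ, u ∈ cube x (2 ^ k * s) := by
    obtain ⟨k, hk⟩ := pow_unbounded_of_one_lt (2 * dist u x / s) one_lt_two
    refine ⟨k, cube_mono x ?_ (closedBall_subset_cube x (dist u x) (mem_closedBall.2 le_rfl))⟩
    exact ((div_lt_iff₀ hs).1 hk).le
  obtain ⟨k, hk⟩ : ∃ k, Nat.find hex = k + 1 := by
    refine Nat.exists_eq_succ_of_ne_zero fun h0 => hu ?_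
    simpa [h0] using Nat.find_spec hex
  refine mem_iUnion.2 ⟨k, ?_, Nat.find_min hex (by omega)⟩
  rw [← hk]
  exact Nat.find_spec hex

theorem aestronglyMeasurable_kernel (hn : 0 < n) {K : E n → E n → ℂ} {x : E n}
    (hK : LocallyIntegrableOn (K x) {x}ᶜ volume) : AEStronglyMeasurable (K x) volume := by
  have : Nonempty (Fin n) := ⟨⟨0, hn⟩⟩
  have h := hK.aestronglyMeasurable
  rwa [restrict_compl_singleton] at h

/-- Hölder with exponents `q, q'` on each shell. As `q' ≤ r`, the `L^{q'}` norm of `h` on a shell is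
at most `|2^{k+1}Q|^{1/q'} M_r h(x)`, and what remains is the Hörmander sum. The core `Q` does not
contribute because `h` vanishes there. -/
theorem lintegral_kernel_sub_mul_le (hn : 0 < n) {q r : ℝ≥0∞} (hq : 1 ≤ q)
    (hqr : q⁻¹ + r⁻¹ ≤ 1) {K : E n → E n → ℂ} (hK : ∀ x, LocallyIntegrableOn (K x) {x}ᶜ volume)
    {h : E n → ℂ} (hh : AEStronglyMeasurable h volume) {x x' : E n} {R : ℝ} (hR : 0 < R)
    (hx' : dist x' x ≤ R / (2 * n)) (hsupp : ∀ u ∈ closedBall x R, h u = 0) :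
    ∫⁻ u, ‖(K x u - K x' u) * h u‖ₑ ≤ hormanderConst q K * maximalFunction r h x := by
  have hn' : (0 : ℝ) < n := by exact_mod_cast hn
  have hq' : q⁻¹ ≤ 1 := ENNReal.inv_le_one.2 hq
  have hqi : q⁻¹ ≠ ∞ := (hq'.trans_lt ENNReal.one_lt_top).ne
  set q' : ℝ≥0∞ := (1 - q⁻¹)⁻¹ with hq'def
  have hinv : q'⁻¹ = 1 - q⁻¹ := inv_inv _
  have : ENNReal.HolderTriple q q' 1 := ⟨by
    rw [hinv, inv_one, add_tsub_cancel_of_le hq']⟩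
  have hq'r : q' ≤ r := by
    rw [hq'def, ENNReal.inv_le_iff_inv_le]
    exact ENNReal.le_sub_of_add_le_left hqi hqr
  -- With this side `Q` still fits in the ball of radius `R`, and `R / (2n) = s / 4` is the
  -- half-side of `Q/2`, so `x' ∈ Q/2`.
  set s : ℝ := 2 * R / n with hs
  have hs0 : 0 < s := by positivity
  have hcube : cube x s ⊆ closedBall x R := by
    have := cube_subset_closedBall x hs0.le
    rwa [show (n : ℝ) * s / 2 = R by rw [hs]; field_simp] at this
  have hxQ : ∀ t, 0 ≤ t → x ∈ cube x t := fun t ht i => by simpa using (by positivity : 0 ≤ t / 2)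
  have hx'Q : x' ∈ cube x (s / 2) := by
    have := closedBall_subset_cube x (R / (2 * n)) (mem_closedBall.2 hx')
    rwa [show 2 * (R / (2 * n)) = s / 2 by rw [hs]; field_simp] at this
  set S : ℕ → Set (E n) := fun k => cube x (2 ^ (k + 1) * s) \ cube x (2 ^ k * s) with hS
  have hd : AEStronglyMeasurable (fun u => K x u - K x' u) volume :=
    (aestronglyMeasurable_kernel hn (hK x)).sub (aestronglyMeasurable_kernel hn (hK x'))
  have hsub : Function.support (fun u => ‖(K x u - K x' u) * h u‖ₑ) ⊆ ⋃ k, S k := by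
    refine Subset.trans (fun u hu => ?_) (compl_cube_subset_iUnion x hs0)
    intro hux
    exact hu (by simp [hsupp u (hcube hux)])
  have hstep : ∀ k, ∫⁻ u in S k, ‖(K x u - K x' u) * h u‖ₑ ≤
      (volume (cube x (2 ^ (k + 1) * s)) ^ (1 - q⁻¹).toReal *
        eLpNorm (fun u => K x u - K x' u) q (volume.restrict (S k))) * maximalFunction r h x := by
    intro k
    have h1 := eLpNorm_smul_le_mul_eLpNorm (p := q) (q := q') (r := 1) (hh.restrict (s := S k))
      (hd.restrict (s := S k))
    rw [eLpNorm_one_eq_lintegral_enorm] at h1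
    have h2 : eLpNorm h q' (volume.restrict (S k)) ≤
        volume (cube x (2 ^ (k + 1) * s)) ^ (1 - q⁻¹).toReal * maximalFunction r h x := by
      rw [← hinv]
      exact (eLpNorm_mono_measure _ (Measure.restrict_mono sdiff_subset le_rfl)).trans
        (eLpNorm_restrict_cube_le hq'r hh (by positivity) (hxQ _ (by positivity)))
    calc ∫⁻ u in S k, ‖(K x u - K x' u) * h u‖ₑ
        ≤ eLpNorm (fun u => K x u - K x' u) q (volume.restrict (S k)) *
          eLpNorm h q' (volume.restrict (S k)) := h1
      _ ≤ eLpNorm (fun u => K x u - K x' u) q (volume.restrict (S k)) *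
          (volume (cube x (2 ^ (k + 1) * s)) ^ (1 - q⁻¹).toReal * maximalFunction r h x) := by
        gcongr
      _ = _ := by ring
  calc ∫⁻ u, ‖(K x u - K x' u) * h u‖ₑ
      = ∫⁻ u in ⋃ k, S k, ‖(K x u - K x' u) * h u‖ₑ :=
        (setLIntegral_eq_of_support_subset hsub).symm
    _ ≤ ∑' k, ∫⁻ u in S k, ‖(K x u - K x' u) * h u‖ₑ := lintegral_iUnion_le _ _
    _ ≤ ∑' k, (volume (cube x (2 ^ (k + 1) * s)) ^ (1 - q⁻¹).toReal *
        eLpNorm (fun u => K x u - K x' u) q (volume.restrict (S k))) * maximalFunction r h x :=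
        ENNReal.tsum_le_tsum hstep
    _ ≤ _ := by
        rw [ENNReal.tsum_mul_right]
        gcongr
        exact le_iSup₂_of_le x s <| le_iSup_of_le hs0 <|
          le_iSup₂_of_le x (hxQ _ (by positivity)) <| le_iSup₂_of_le x' hx'Q le_rfl

theorem integrable_kernel_mul {K : E n → E n → ℂ} {x : E n}
    (hK : LocallyIntegrableOn (K x) {x}ᶜ volume) {h : E n → ℂ} (hh : MemLp h ∞ volume)
    (hc : HasCompactSupport h) (hx : x ∉ tsupport h) :
    Integrable (fun u => K x u * h u) volume := by
  have h1 : IntegrableOn (K x) (tsupport h) volume :=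
    hK.integrableOn_compact_subset (fun u hu hux => hx (hux ▸ hu)) hc
  have h2 : IntegrableOn (fun u => K x u * h u) (tsupport h) volume :=
    h1.mul_of_top_left (hh.restrict _)
  exact (integrableOn_iff_integrable_of_support_subset fun u hu => subset_tsupport h
    fun h0 => hu (by simp [h0])).1 h2

theorem notMem_tsupport_of_ball {h : E n → ℂ} {x x' : E n} {R : ℝ}
    (hsupp : ∀ u ∈ closedBall x R, h u = 0) (hx' : dist x' x < R) : x' ∉ tsupport h := by
  rw [notMem_tsupport_iff_eventuallyEq]
  filter_upwards [isOpen_ball.mem_nhds (mem_ball.2 hx')] with u hu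
  exact hsupp u (ball_subset_closedBall hu)

theorem enorm_integral_kernel_le (hn : 0 < n) {q r : ℝ≥0∞} (hq : 1 ≤ q)
    (hqr : q⁻¹ + r⁻¹ ≤ 1) {K : E n → E n → ℂ} (hK : ∀ x, LocallyIntegrableOn (K x) {x}ᶜ volume)
    {h : E n → ℂ} (hh : MemLp h ∞ volume) (hc : HasCompactSupport h) {x x' : E n} {R : ℝ}
    (hR : 0 < R) (hx' : dist x' x ≤ R / (2 * n)) (hsupp : ∀ u ∈ closedBall x R, h u = 0) :
    ‖∫ u, K x u * h u‖ₑ ≤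
      ‖∫ u, K x' u * h u‖ₑ + hormanderConst q K * maximalFunction r h x := by
  have hn' : (1 : ℝ) ≤ n := by exact_mod_cast hn
  have hlt : dist x' x < R := by
    refine hx'.trans_lt ?_
    rw [div_lt_iff₀ (by positivity)]
    nlinarith
  have hi := integrable_kernel_mul (hK x) hh hc (notMem_tsupport_of_ball hsupp (by simpa using hR))
  have hi' := integrable_kernel_mul (hK x') hh hc (notMem_tsupport_of_ball hsupp hlt)
  have heq : ∫ u, K x u * h u = (∫ u, K x' u * h u) + ∫ u, (K x u - K x' u) * h u := by
    simp_rw [sub_mul]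
    rw [integral_sub hi hi', add_sub_cancel]
  rw [heq]
  refine (enorm_add_le _ _).trans ?_
  gcongr
  exact (enorm_integral_le_lintegral_enorm _).trans
    (lintegral_kernel_sub_mul_le hn hq hqr hK hh.1 hR hx' hsupp)

/-! ### Truncations -/

theorem measurableSet_dist_gt (x : E n) (ε : ℝ) : MeasurableSet {y : E n | ε < ‖x - y‖} :=
  (isOpen_lt continuous_const (by fun_prop)).measurableSet

theorem truncated_eq_integral (K : E n → E n → ℂ) (ε : ℝ) (f : E n → ℂ) (x : E n) :
    truncated K ε f x = ∫ y, K x y * ({y : E n | ε < ‖x - y‖}.indicator f) y := by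
  rw [truncated, ← integral_indicator (measurableSet_dist_gt x ε)]
  congr 1
  ext y
  by_cases hy : y ∈ {y : E n | ε < ‖x - y‖}
  · rw [indicator_of_mem hy, indicator_of_mem hy]
  · rw [indicator_of_notMem hy, indicator_of_notMem hy, mul_zero]

theorem indicator_dist_gt_eq_zero (f : E n → ℂ) {ε : ℝ} {x u : E n} (hu : u ∈ closedBall x ε) :
    ({y : E n | ε < ‖x - y‖}.indicator f) u = 0 := by
  refine indicator_of_notMem (fun h => ?_) f
  rw [mem_closedBall, dist_comm, dist_eq_norm] at hu
  exact absurd h (not_lt.2 hu)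

/-- Splitting a truncated integral along a set. -/
theorem truncated_eq_add {K : E n → E n → ℂ} {x : E n} (hK : LocallyIntegrableOn (K x) {x}ᶜ volume)
    {f : E n → ℂ} (hf : MemLp f ∞ volume) (hc : HasCompactSupport f) {S : Set (E n)}
    (hS : MeasurableSet S) {ε : ℝ} (hε : 0 < ε) :
    truncated K ε f x = truncated K ε (S.indicator f) x +
      ∫ y, K x y * ((S ∪ closedBall x ε)ᶜ.indicator f) y := by
  have hx : ∀ h : E n → ℂ, (∀ u ∈ closedBall x ε, h u = 0) → x ∉ tsupport h :=
    fun h hh => notMem_tsupport_of_ball hh (by simpa using hε)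
  have hm := measurableSet_dist_gt x ε
  rw [truncated_eq_integral, truncated_eq_integral, ← integral_add]
  · congr 1
    ext y
    rw [← mul_add]
    congr 1
    have hy : y ∈ closedBall x ε ↔ ¬ (ε < ‖x - y‖) := by
      rw [mem_closedBall, dist_comm, dist_eq_norm, not_lt]
    by_cases h1 : ε < ‖x - y‖ <;> by_cases h2 : y ∈ S <;>
      simp [hy, h1, h2, -mem_closedBall]
  · exact integrable_kernel_mul hK ((hf.indicator hS).indicator hm)
      (hasCompactSupport_indicator (hasCompactSupport_indicator hc _) _)
      (hx _ fun u hu => indicator_dist_gt_eq_zero _ hu)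
  · exact integrable_kernel_mul hK (hf.indicator (hS.union measurableSet_closedBall).compl)
      (hasCompactSupport_indicator hc _)
      (hx _ fun u hu => indicator_of_notMem (notMem_compl_iff.2 (mem_union_right S hu)) f)

/-! ### The local Cotlar inequality -/

variable {q r : ℝ≥0∞} {T : (E n → ℂ) → E n → ℂ} {K : E n → E n → ℂ} {A : Type*}
  {φ : A → E n → ℝ}

theorem hasCompactSupport_modulate {f : E n → ℂ} (hc : HasCompactSupport f) (a : E n → ℝ) :
    HasCompactSupport (modulate a f) :=
  hc.of_isClosed_subset (isClosed_tsupport _) (tsupport_modulate_subset a f)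

/-- Off the support, the operator applied to `f` restricted to `Gᶜ` is controlled by the maximally
modulated operator applied to `f` and to the restriction of `f` to `G`. -/
theorem enorm_integral_kernel_compl_le (hT : IsCalderonZygmund q T K)
    (hφ : ∀ α, Measurable (φ α)) {f : E n → ℂ} (hf : MemLp f ∞ volume) (hc : HasCompactSupport f)
    {G : Set (E n)} (hG : MeasurableSet G) (α : A) {x : E n}
    (hx : x ∉ tsupport (Gᶜ.indicator (modulate (φ α) f))) :
    ‖∫ u, K x u * (Gᶜ.indicator (modulate (φ α) f)) u‖ₑ ≤
      maxModulated T φ f x + maxModulated T φ (G.indicator f) x := by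
  set w := modulate (φ α) f with hw
  have hwm : MemLp w ∞ volume := memLp_modulate (hφ α) hf
  have hwc : HasCompactSupport w := hasCompactSupport_modulate hc _
  have hint : ∀ S, MeasurableSet S → Integrable (S.indicator w) volume := fun S hS =>
    memLp_one_iff_integrable.1 (memLp_of_hasCompactSupport (hwm.indicator hS)
      (hasCompactSupport_indicator hwc S))
  rw [← hT.representation _ (hwm.indicator hG.compl) (hasCompactSupport_indicator hwc _) x hx]
  -- Additivity is an identity of functions at every point, so it may be evaluated at the given `x`.
  have hadd := hT.map_add (G.indicator w) (Gᶜ.indicator w) (hint G hG) (hint _ hG.compl)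
  rw [indicator_self_add_compl] at hadd
  have h1 : T (Gᶜ.indicator w) x = T w x - T (G.indicator w) x := by
    rw [hadd, Pi.add_apply, add_sub_cancel_left]
  rw [h1]
  refine enorm_sub_le.trans (add_le_add ?_ ?_)
  · exact le_iSup (fun α => ‖T (modulate (φ α) f) x‖ₑ) α
  · rw [hw, ← modulate_indicator]
    exact le_iSup (fun α => ‖T (modulate (φ α) (G.indicator f)) x‖ₑ) α

theorem eLpNorm_indicator_ball_le {p : ℝ} (hp : 0 < p) (hpr : ENNReal.ofReal p ≤ r)
    {f : E n → ℂ} (hf : AEStronglyMeasurable f volume) {G : Set (E n)} (hG : MeasurableSet G)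
    {x y : E n} {R : ℝ} (hR : 0 < R) (hGR : G ⊆ closedBall y R) (hx : x ∈ closedBall y R) :
    eLpNorm (G.indicator f) (ENNReal.ofReal p) volume ≤
      volume (cube y (2 * R)) ^ (1 / p) * maximalFunction r f x := by
  have hp' : (ENNReal.ofReal p)⁻¹.toReal = 1 / p := by
    rw [ENNReal.toReal_inv, ENNReal.toReal_ofReal hp.le, one_div]
  rw [eLpNorm_indicator_eq_eLpNorm_restrict hG, ← hp']
  exact (eLpNorm_mono_measure _ (Measure.restrict_mono
    (hGR.trans (closedBall_subset_cube y R)) le_rfl)).trans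
    (eLpNorm_restrict_cube_le hpr hf (by positivity) (closedBall_subset_cube y R hx))

/-- The scale cancels: a weak-type threshold at measure `m`, times the Hölder factor of a cube of
comparable measure, is a constant. -/
theorem rpow_neg_mul_rpow_le {m S L : ℝ≥0∞} (hm : m ≠ 0) (hm' : m ≠ ∞) (hS : S ≤ L * m) {a : ℝ}
    (ha : 0 ≤ a) : m ^ (-a) * S ^ a ≤ L ^ a := by
  calc m ^ (-a) * S ^ a ≤ m ^ (-a) * (L * m) ^ a := by gcongr
    _ = L ^ a := by
      rw [ENNReal.mul_rpow_of_nonneg _ _ ha, mul_left_comm, ← ENNReal.rpow_add _ _ hm hm',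
        neg_add_cancel, ENNReal.rpow_zero, mul_one]

theorem quarter_add_half_lt {V : ℝ≥0∞} (hV : V ≠ 0) (hV' : V ≠ ∞) : V / 4 + V / 2 < V := by
  lift V to ℝ≥0 using hV'
  have hpos : (0 : ℝ) < V := NNReal.coe_pos.2 (pos_iff_ne_zero.2 (by exact_mod_cast hV))
  have h : V / 4 + V / 2 < V := by
    rw [← NNReal.coe_lt_coe]
    push_cast
    linarith
  have h' := ENNReal.coe_lt_coe.2 h
  rwa [ENNReal.coe_add, ENNReal.coe_div (by norm_num), ENNReal.coe_div (by norm_num)] at h'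

/-- A localization of Cotlar's inequality. If `T^F g` is at most `b` outside a set which has small
density in all balls centred at `y` with radius larger than `2 ρ`, then near `y` the maximal
operator is controlled by its action on the restriction of `g` to a ball of radius `15 ρ`. -/
theorem exists_maxModulatedMaximal_le (hn : 0 < n) (hq : 1 ≤ q) (hqr : q⁻¹ + r⁻¹ ≤ 1)
    (hT : IsCalderonZygmund q T K) (hφ : ∀ α, Measurable (φ α)) {p : ℝ} (hp : 0 < p)
    (hpr : ENNReal.ofReal p ≤ r) {B : ℝ≥0}
    (hB : ∀ f : E n → ℂ, MemLp f (ENNReal.ofReal p) volume → HasCompactSupport f →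
      weakNorm p (maxModulated T φ f) ≤ B * eLpNorm f (ENNReal.ofReal p) volume) :
    ∃ κ C : ℝ≥0∞, κ ≠ 0 ∧ κ ≠ ∞ ∧ C ≠ ∞ ∧
      ∀ g : E n → ℂ, MemLp g ∞ volume → HasCompactSupport g → ∀ (Ω : Set (E n)) (b : ℝ≥0∞),
      (∀ x ∉ Ω, maxModulated T φ g x ≤ b) → ∀ (y : E n) (ρ : ℝ), 0 ≤ ρ →
      (∀ R, 2 * ρ < R → volume (closedBall y R ∩ Ω) ≤ κ * volume (closedBall y R)) →
      ∀ x, dist x y ≤ 5 * ρ →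
        maxModulatedMaximal K φ g x ≤
          maxModulatedMaximal K φ ((closedBall y (15 * ρ)).indicator g) x + b +
            C * maximalFunction r g x := by
  have hn' : (1 : ℝ) ≤ n := by exact_mod_cast hn
  set δ : ℝ := 1 / (2 * n) with hδ
  have hδ0 : 0 < δ := by positivity
  have hδ1 : δ ≤ 1 := by
    rw [hδ, div_le_one (by positivity)]
    linarith
  -- The constants are tied to `V = |B(x, δR)|`, the ball in which `x'` is sought: density `κ` in
  -- `B(y, 2R)` leaves at most `V/4` of `Ω`, and the cube of side `4R` has measure at most `L ·
  -- V/2`.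
  set κ : ℝ≥0∞ := (ENNReal.ofReal ((2 / δ) ^ n))⁻¹ * 4⁻¹ with hκ
  set L : ℝ≥0∞ := ENNReal.ofReal ((n * (4 / δ) / 2) ^ n) * 2 with hL
  have hD0 : ENNReal.ofReal ((2 / δ) ^ n) ≠ 0 := by
    simp only [ne_eq, ENNReal.ofReal_eq_zero, not_le]
    positivity
  have h1p : 0 < 1 / p := by positivity
  refine ⟨κ, B * L ^ (1 / p) + hormanderConst q K, ?_, ?_, ?_, ?_⟩
  · exact mul_ne_zero (ENNReal.inv_ne_zero.2 ENNReal.ofReal_ne_top) (by simp)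
  · exact ENNReal.mul_ne_top (ENNReal.inv_ne_top.2 hD0) (by simp)
  · refine ENNReal.add_ne_top.2 ⟨ENNReal.mul_ne_top ENNReal.coe_ne_top
      (ENNReal.rpow_ne_top_of_nonneg h1p.le ?_), hT.hormander.ne⟩
    exact ENNReal.mul_ne_top ENNReal.ofReal_ne_top (by simp)
  intro g hg hgc Ω b hΩ y ρ hρ hdens x hxy
  refine iSup₂_le fun ε hε => iSup_le fun α => ?_
  set w := modulate (φ α) g with hw
  have hwm : MemLp w ∞ volume := memLp_modulate (hφ α) hg
  have hwc : HasCompactSupport w := hasCompactSupport_modulate hgc _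
  set G : Set (E n) := closedBall y (15 * ρ) ∪ closedBall x ε with hGdef
  have hG : MeasurableSet G := measurableSet_closedBall.union measurableSet_closedBall
  -- As `|x - y| ≤ 5ρ`, this radius gives `B(x, R) ⊆ G ⊆ B(x, 2R)`. Also `2R > 2ρ`, even for `ρ =
  -- 0`, so the density hypothesis applies.
  set R : ℝ := max (10 * ρ) ε with hRdef
  have hR : 0 < R := hε.trans_le (le_max_right _ _)
  have hRρ : 10 * ρ ≤ R := le_max_left _ _
  have hRG : closedBall x R ⊆ G := by
    rcases le_total (10 * ρ) ε with h | h
    · rw [hRdef, max_eq_right h]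
      exact subset_union_right
    · rw [hRdef, max_eq_left h]
      exact subset_union_of_subset_left (closedBall_subset_closedBall' (by linarith)) _
  have hGR : G ⊆ closedBall x (2 * R) := by
    refine union_subset (closedBall_subset_closedBall' ?_) (closedBall_subset_closedBall ?_)
    · rw [dist_comm]
      linarith
    · linarith [le_max_right (10 * ρ) ε]
  have hδR : 0 < δ * R := by positivity
  set V : ℝ≥0∞ := volume (closedBall x (δ * R)) with hV
  have hV0 : V ≠ 0 := volume_closedBall_ne_zero x hδR
  have hVt : V ≠ ∞ := volume_closedBall_ne_top x _
  set m : ℝ≥0∞ := V / 2 with hm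
  have hm0 : m ≠ 0 := (ENNReal.half_pos hV0).ne'
  have hmt : m ≠ ∞ := ENNReal.div_ne_top hVt two_ne_zero
  have hΩV : volume (closedBall x (δ * R) ∩ Ω) ≤ V / 4 := by
    have hsub : closedBall x (δ * R) ⊆ closedBall y (2 * R) := by
      refine closedBall_subset_closedBall' ?_
      nlinarith
    calc volume (closedBall x (δ * R) ∩ Ω) ≤ volume (closedBall y (2 * R) ∩ Ω) := by gcongr
      _ ≤ κ * volume (closedBall y (2 * R)) := hdens _ (by linarith)
      _ = V / 4 := by
        rw [show 2 * R = (2 / δ) * (δ * R) by field_simp,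
          volume_closedBall_mul y x (by positivity) hδR.le, hκ, mul_right_comm, ← mul_assoc,
          ENNReal.inv_mul_cancel hD0 ENNReal.ofReal_ne_top, one_mul, ← div_eq_mul_inv]
  have hgG : MemLp (G.indicator g) ∞ volume := hg.indicator hG
  have hgGc : HasCompactSupport (G.indicator g) := hasCompactSupport_indicator hgc G
  have hgGp : MemLp (G.indicator g) (ENNReal.ofReal p) volume :=
    memLp_of_hasCompactSupport hgG hgGc
  set W : ℝ≥0∞ := B * eLpNorm (G.indicator g) (ENNReal.ofReal p) volume with hWdef
  have hN := volume_superlevel_le hp (hB _ hgGp hgGc)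
    (ENNReal.mul_ne_top ENNReal.coe_ne_top hgGp.2.ne) hm0 hmt
  -- The two exceptional sets occupy at most `V/4 + V/2 < V` of the ball.
  obtain ⟨x', hx'B, hx'Ω, hx'N⟩ : ∃ x' ∈ closedBall x (δ * R), x' ∉ Ω ∧
      maxModulated T φ (G.indicator g) x' ≤ m ^ (-(1 / p)) * W := by
    by_contra! hcon
    have hcov : closedBall x (δ * R) ⊆ (closedBall x (δ * R) ∩ Ω) ∪
        {x | m ^ (-(1 / p)) * W < maxModulated T φ (G.indicator g) x} := by
      intro u hu
      by_cases hu' : u ∈ Ω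
      · exact Or.inl ⟨hu, hu'⟩
      · exact Or.inr (hcon u hu hu')
    exact absurd ((measure_mono hcov).trans ((measure_union_le _ _).trans (add_le_add hΩV hN)))
      (not_le.2 (quarter_add_half_lt hV0 hVt))
  have hWle : m ^ (-(1 / p)) * W ≤ B * L ^ (1 / p) * maximalFunction r g x := by
    have h1 : eLpNorm (G.indicator g) (ENNReal.ofReal p) volume ≤
        volume (cube x (2 * (2 * R))) ^ (1 / p) * maximalFunction r g x :=
      eLpNorm_indicator_ball_le hp hpr hg.1 hG (by positivity) hGR
        (mem_closedBall_self (by positivity))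
    have h2 : volume (cube x (2 * (2 * R))) ≤ L * m := by
      rw [show 2 * (2 * R) = (4 / δ) * (δ * R) by field_simp; norm_num]
      refine (volume_cube_le x x (by positivity) hδR.le).trans_eq ?_
      rw [hL, hm, mul_assoc, ENNReal.mul_div_cancel two_ne_zero ENNReal.ofNat_ne_top]
    calc m ^ (-(1 / p)) * W
        ≤ m ^ (-(1 / p)) *
          (B * (volume (cube x (2 * (2 * R))) ^ (1 / p) * maximalFunction r g x)) := by
          rw [hWdef]
          gcongr
      _ = B * (m ^ (-(1 / p)) * volume (cube x (2 * (2 * R))) ^ (1 / p)) *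
          maximalFunction r g x := by ring
      _ ≤ _ := by
          gcongr
          exact rpow_neg_mul_rpow_le hm0 hmt h2 h1p.le
  have hsupp : ∀ u ∈ closedBall x R, (Gᶜ.indicator w) u = 0 := fun u hu =>
    indicator_of_notMem (notMem_compl_iff.2 (hRG hu)) w
  have hx'R : dist x' x ≤ R / (2 * n) := by
    refine (mem_closedBall.1 hx'B).trans_eq ?_
    rw [hδ]
    ring
  have hx'lt : dist x' x < R := by
    refine hx'R.trans_lt ?_
    rw [div_lt_iff₀ (by positivity)]
    nlinarith
  rw [truncated_eq_add (hT.locallyIntegrableOn_kernel x) hwm hwc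
    (measurableSet_closedBall (x := y) (ε := 15 * ρ)) hε]
  refine (enorm_add_le _ _).trans ?_
  rw [add_assoc]
  refine add_le_add ?_ ?_
  · rw [hw, ← modulate_indicator]
    exact le_iSup₂_of_le ε hε <| le_iSup (fun α => ‖truncated K ε
      (modulate (φ α) ((closedBall y (15 * ρ)).indicator g)) x‖ₑ) α
  · have hmax : maximalFunction r (Gᶜ.indicator w) x ≤ maximalFunction r g x := by
      refine maximalFunction_mono r (fun u => ?_) x
      exact (norm_indicator_le_norm_self w u).trans (norm_modulate _ _ _).le
    calc ‖∫ u, K x u * (Gᶜ.indicator w) u‖ₑ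
        ≤ ‖∫ u, K x' u * (Gᶜ.indicator w) u‖ₑ +
          hormanderConst q K * maximalFunction r (Gᶜ.indicator w) x :=
          enorm_integral_kernel_le hn hq hqr hT.locallyIntegrableOn_kernel
            (hwm.indicator hG.compl) (hasCompactSupport_indicator hwc _) hR hx'R hsupp
      _ ≤ (b + B * L ^ (1 / p) * maximalFunction r g x) +
          hormanderConst q K * maximalFunction r g x := by
          gcongr
          exact (enorm_integral_kernel_compl_le hT hφ hg hgc hG α
            (notMem_tsupport_of_ball hsupp hx'lt)).trans
            (add_le_add (hΩ x' hx'Ω) (hx'N.trans hWle))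
      _ = _ := by ring

/-! ### Stopping balls -/

/-- Balls in which a set of finite measure has density above `κ` have bounded radii, as the Vitali
covering lemma requires. For `R ≥ 1` the bound `R ≤ R^n` suffices. -/
theorem radius_le_of_volume_lt (hn : 0 < n) {κ v : ℝ≥0∞} (hκ : κ ≠ 0) (hv : v ≠ ∞) :
    ∃ R₀ : ℝ, ∀ (x : E n) (R : ℝ), κ * volume (closedBall x R) < v → R ≤ R₀ := by
  set V : ℝ≥0∞ := volume (closedBall (0 : E n) 1) with hV
  have hV0 : V ≠ 0 := volume_closedBall_ne_zero 0 one_pos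
  have hVt : V ≠ ∞ := volume_closedBall_ne_top 0 1
  refine ⟨max 1 (v / (κ * V)).toReal, fun x R hR => ?_⟩
  by_contra! hlt
  obtain ⟨h1, h2⟩ := max_lt_iff.1 hlt
  have hX : v / (κ * V) ≠ ∞ := ENNReal.div_ne_top hv (mul_ne_zero hκ hV0)
  have h3 : v / (κ * V) < ENNReal.ofReal R := by
    rwa [ENNReal.lt_ofReal_iff_toReal_lt hX]
  have h4 : ENNReal.ofReal R * V ≤ volume (closedBall x R) := by
    have h := volume_closedBall_mul x 0 (by linarith : 0 ≤ R) zero_le_one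
    rw [mul_one] at h
    rw [h]
    gcongr
    exact le_self_pow₀ h1.le hn.ne'
  refine lt_irrefl v (lt_of_le_of_lt ?_ hR)
  have h5 := (ENNReal.div_le_iff_le_mul (Or.inr (ENNReal.ofReal_ne_top (r := R)))
    (Or.inr (by simpa using (by linarith : 0 < R)))).1 h3.le
  calc v ≤ ENNReal.ofReal R * (κ * V) := h5
    _ = κ * (ENNReal.ofReal R * V) := by ring
    _ ≤ κ * volume (closedBall x R) := by gcongr

/-- A stopping-time family of balls for the density of a set of finite measure: the balls cover all
points at which the set has large density at some scale, and their centres see a small density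
above the scale of the ball. -/
theorem exists_stopping_balls (hn : 0 < n) {κ : ℝ≥0∞} (hκ : κ ≠ 0) (hκ' : κ ≠ ∞)
    {Ω : Set (E n)} (hΩ : volume Ω ≠ ∞) :
    ∃ (u : Set (E n)) (ρ : E n → ℝ), u.Countable ∧
      (∀ a ∈ u, 0 < ρ a ∧
        ∀ R, 2 * ρ a < R → volume (closedBall a R ∩ Ω) ≤ κ * volume (closedBall a R)) ∧
      ∑' a : u, volume (closedBall (a : E n) (5 * ρ a)) ≤
        ENNReal.ofReal (5 ^ n) * (κ⁻¹ * volume Ω) ∧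
      ∀ x, x ∉ ⋃ a ∈ u, closedBall a (5 * ρ a) →
        ∀ R, 0 < R → volume (closedBall x R ∩ Ω) ≤ κ * volume (closedBall x R) := by
  classical
  set D : E n → Set ℝ := fun x =>
    {R | 0 < R ∧ κ * volume (closedBall x R) < volume (closedBall x R ∩ Ω)} with hD
  obtain ⟨R₀, hR₀⟩ := radius_le_of_volume_lt hn hκ hΩ
  have hDR : ∀ x, ∀ R ∈ D x, R ≤ R₀ := fun x R hR =>
    hR₀ x R (hR.2.trans_le (measure_mono inter_subset_right))
  have hex : ∀ x, ∃ ρ : ℝ, (D x).Nonempty → ρ ∈ D x ∧ ∀ R ∈ D x, R ≤ 2 * ρ := by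
    intro x
    by_cases hx : (D x).Nonempty
    · have hbdd : BddAbove (D x) := ⟨R₀, hDR x⟩
      obtain ⟨R₁, hR₁⟩ := hx
      have hpos : 0 < sSup (D x) := hR₁.1.trans_le (le_csSup hbdd hR₁)
      -- A radius above half the supremum is dense itself, while no radius beyond `2ρ` is.
      obtain ⟨ρ, hρ, hlt⟩ := exists_lt_of_lt_csSup ⟨R₁, hR₁⟩ (half_lt_self hpos)
      exact ⟨ρ, fun _ => ⟨hρ, fun R hR => (le_csSup hbdd hR).trans (by linarith)⟩⟩
    · exact ⟨0, fun h => absurd h hx⟩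
  choose ρ hρ using hex
  obtain ⟨u, hut, hdisj, hcov⟩ := Vitali.exists_disjoint_subfamily_covering_enlargement_closedBall
    {x | (D x).Nonempty} id ρ R₀ (fun a ha => hDR a _ (hρ a ha).1) 5 (by norm_num)
  have hu : u.Countable := by
    refine hdisj.countable_of_nonempty_interior fun a ha => ?_
    exact (nonempty_ball.2 (hρ a (hut ha)).1.1).mono ball_subset_interior_closedBall
  refine ⟨u, ρ, hu, fun a ha => ⟨(hρ a (hut ha)).1.1, fun R hR => ?_⟩, ?_, fun x hx R hR => ?_⟩
  · by_contra! hlt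
    exact absurd ((hρ a (hut ha)).2 R ⟨by linarith [(hρ a (hut ha)).1.1], hlt⟩) (not_le.2 hR)
  · have hball : ∀ a : u, volume (closedBall (a : E n) (5 * ρ a)) ≤
        ENNReal.ofReal (5 ^ n) * (κ⁻¹ * volume.restrict Ω (closedBall (a : E n) (ρ a))) := by
      intro a
      have ha := (hρ a (hut a.2)).1
      rw [volume_closedBall_mul (a : E n) (a : E n) (by norm_num) ha.1.le,
        Measure.restrict_apply measurableSet_closedBall]
      gcongr
      rw [mul_comm, ← div_eq_mul_inv,
        ENNReal.le_div_iff_mul_le (Or.inl hκ) (Or.inl hκ'), mul_comm]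
      exact ha.2.le
    refine (ENNReal.tsum_le_tsum hball).trans ?_
    rw [ENNReal.tsum_mul_left, ENNReal.tsum_mul_left]
    gcongr
    -- Additivity is applied to disjoint balls under the restricted measure, so `Ω` need not be
    -- measurable.
    have h := measure_biUnion (μ := volume.restrict Ω) hu hdisj
      (fun a _ => measurableSet_closedBall)
    simp only [id_eq] at h
    rw [← h]
    exact (measure_mono (subset_univ _)).trans_eq (Measure.restrict_apply_univ Ω)
  · by_contra! hlt
    have hxD : x ∈ {x | (D x).Nonempty} := ⟨R, hR, hlt⟩
    obtain ⟨b, hb, hsub⟩ := hcov x hxD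
    refine hx (mem_iUnion₂.2 ⟨b, hb, hsub (mem_closedBall_self (hρ x hxD).1.1.le)⟩)

/-! ### Decomposition and iteration -/

/-- The local term of the Cotlar inequality when `ρ = 0`: the ball is a point, which every
truncation omits. -/
theorem maxModulatedMaximal_indicator_point (K : E n → E n → ℂ) (φ : A → E n → ℝ) (g : E n → ℂ)
    (x : E n) : maxModulatedMaximal K φ ((closedBall x (15 * 0)).indicator g) x = 0 := by
  refine nonpos_iff_eq_zero.1 (iSup₂_le fun ε hε => iSup_le fun α => ?_)
  have h : truncated K ε (modulate (φ α) ((closedBall x (15 * 0)).indicator g)) x = 0 := by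
    rw [truncated, setIntegral_eq_zero_of_forall_eq_zero]
    intro y hy
    have hyx : y ∉ closedBall x (15 * 0) := by
      rw [mem_closedBall, dist_comm, dist_eq_norm, mul_zero, not_le]
      exact hε.trans hy
    rw [modulate, indicator_of_notMem hyx, mul_zero, mul_zero]
  rw [h, enorm_zero]

theorem hasCompactSupport_of_closedBall {g : E n → ℂ} {z : E n} {R : ℝ}
    (hg : ∀ u ∉ closedBall z R, g u = 0) : HasCompactSupport g :=
  HasCompactSupport.intro (isCompact_closedBall z R) hg

/-- One step of the stopping-time argument. -/
theorem exists_stopping_decomposition (hn : 0 < n) (hq : 1 ≤ q) (hqr : q⁻¹ + r⁻¹ ≤ 1)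
    (hT : IsCalderonZygmund q T K) (hφ : ∀ α, Measurable (φ α)) {p : ℝ} (hp : 0 < p)
    (hpr : ENNReal.ofReal p ≤ r) {B : ℝ≥0}
    (hB : ∀ f : E n → ℂ, MemLp f (ENNReal.ofReal p) volume → HasCompactSupport f →
      weakNorm p (maxModulated T φ f) ≤ B * eLpNorm f (ENNReal.ofReal p) volume) :
    ∃ C : ℝ≥0∞, C ≠ ∞ ∧ ∀ (z : E n) (ρ₀ : ℝ), 0 < ρ₀ → ∀ g : E n → ℂ, MemLp g ∞ volume →
      (∀ u ∉ closedBall z (3 * ρ₀), g u = 0) →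
      ∃ (u : Set (E n)) (ρ : E n → ℝ), u.Countable ∧ (∀ a ∈ u, 0 < ρ a) ∧
        ∑' a : u, volume (closedBall (a : E n) (ρ a)) ≤ 2⁻¹ * volume (closedBall z ρ₀) ∧
        ∀ x ∈ closedBall z ρ₀,
          maxModulatedMaximal K φ g x ≤ C * maximalFunction r g x ∨
          ∃ a ∈ u, x ∈ closedBall a (ρ a) ∧ maxModulatedMaximal K φ g x ≤
            maxModulatedMaximal K φ ((closedBall a (3 * ρ a)).indicator g) x +
              C * maximalFunction r g x := by
  obtain ⟨κ, C, hκ, hκ', hC, hloc⟩ := exists_maxModulatedMaximal_le hn hq hqr hT hφ hp hpr hB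
  set N : ℝ≥0∞ := ENNReal.ofReal (5 ^ n) with hN
  have hN0 : N ≠ 0 := by
    simp only [hN, ne_eq, ENNReal.ofReal_eq_zero, not_le]
    positivity
  have hNt : N ≠ ∞ := ENNReal.ofReal_ne_top
  -- Solves `5^n κ⁻¹ θ = 1/2`, which makes the enlarged stopping balls fill at most half of the
  -- original ball.
  set θ : ℝ≥0∞ := N⁻¹ * κ * 2⁻¹ with hθ
  have hθ0 : θ ≠ 0 := mul_ne_zero (mul_ne_zero (ENNReal.inv_ne_zero.2 hNt) hκ) (by simp)
  have hθt : θ ≠ ∞ := ENNReal.mul_ne_top (ENNReal.mul_ne_top (ENNReal.inv_ne_top.2 hN0) hκ')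
    (by simp)
  set L : ℝ≥0∞ := ENNReal.ofReal ((n * 6 / 2) ^ n) * θ⁻¹ with hL
  have h1p : 0 < 1 / p := by positivity
  refine ⟨B * L ^ (1 / p) + C, ENNReal.add_ne_top.2 ⟨ENNReal.mul_ne_top ENNReal.coe_ne_top
    (ENNReal.rpow_ne_top_of_nonneg h1p.le
      (ENNReal.mul_ne_top ENNReal.ofReal_ne_top (ENNReal.inv_ne_top.2 hθ0))), hC⟩, ?_⟩
  intro z ρ₀ hρ₀ g hg hgz
  have hgc : HasCompactSupport g := hasCompactSupport_of_closedBall hgz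
  have hgp : MemLp g (ENNReal.ofReal p) volume := memLp_of_hasCompactSupport hg hgc
  set V : ℝ≥0∞ := volume (closedBall z ρ₀) with hV
  have hV0 : V ≠ 0 := volume_closedBall_ne_zero z hρ₀
  have hVt : V ≠ ∞ := volume_closedBall_ne_top z ρ₀
  have hm0 : θ * V ≠ 0 := mul_ne_zero hθ0 hV0
  have hmt : θ * V ≠ ∞ := ENNReal.mul_ne_top hθt hVt
  set b : ℝ≥0∞ := (θ * V) ^ (-(1 / p)) * (B * eLpNorm g (ENNReal.ofReal p) volume) with hb
  set Ω : Set (E n) := {x | b < maxModulated T φ g x} with hΩdef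
  have hΩ : volume Ω ≤ θ * V := volume_superlevel_le hp (hB g hgp hgc)
    (ENNReal.mul_ne_top ENNReal.coe_ne_top hgp.2.ne) hm0 hmt
  have hΩb : ∀ x ∉ Ω, maxModulated T φ g x ≤ b := fun x hx => not_lt.1 hx
  have hbM : ∀ x ∈ closedBall z ρ₀, b ≤ B * L ^ (1 / p) * maximalFunction r g x := by
    intro x hx
    have hind : (closedBall z (3 * ρ₀)).indicator g = g :=
      indicator_eq_self.2 fun u hu => by_contra fun hu' => hu (hgz u hu')
    have h1 : eLpNorm g (ENNReal.ofReal p) volume ≤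
        volume (cube z (2 * (3 * ρ₀))) ^ (1 / p) * maximalFunction r g x := by
      have h := eLpNorm_indicator_ball_le hp hpr hg.1 measurableSet_closedBall
        (by positivity : 0 < 3 * ρ₀) subset_rfl (closedBall_subset_closedBall (by linarith) hx)
      rwa [hind] at h
    have h2 : volume (cube z (2 * (3 * ρ₀))) ≤ L * (θ * V) := by
      rw [show 2 * (3 * ρ₀) = 6 * ρ₀ by ring, hL, mul_assoc, ← mul_assoc θ⁻¹,
        ENNReal.inv_mul_cancel hθ0 hθt, one_mul]
      exact volume_cube_le z z (by norm_num) hρ₀.le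
    calc b ≤ (θ * V) ^ (-(1 / p)) *
          (B * (volume (cube z (2 * (3 * ρ₀))) ^ (1 / p) * maximalFunction r g x)) := by
          rw [hb]
          gcongr
      _ = B * ((θ * V) ^ (-(1 / p)) * volume (cube z (2 * (3 * ρ₀))) ^ (1 / p)) *
          maximalFunction r g x := by ring
      _ ≤ _ := by
          gcongr
          exact rpow_neg_mul_rpow_le hm0 hmt h2 h1p.le
  obtain ⟨u, ρ, hu, hρ, hsum, hgood⟩ := exists_stopping_balls hn hκ hκ' (hΩ.trans_lt hmt.lt_top).ne
  -- The selected balls are the enlarged ones, so that `15ρ = 3 · 5ρ` restores the support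
  -- hypothesis for the next step.
  refine ⟨u, fun a => 5 * ρ a, hu, fun a ha => by linarith [(hρ a ha).1], ?_, fun x hx => ?_⟩
  · refine hsum.trans ?_
    calc N * (κ⁻¹ * volume Ω) ≤ N * (κ⁻¹ * (θ * V)) := by gcongr
      _ = (N * N⁻¹) * (κ⁻¹ * κ) * (2⁻¹ * V) := by
        rw [hθ]
        ring
      _ = 2⁻¹ * V := by
        rw [ENNReal.mul_inv_cancel hN0 hNt, ENNReal.inv_mul_cancel hκ hκ', one_mul, one_mul]
  · have hadd : b + C * maximalFunction r g x ≤
        (B * L ^ (1 / p) + C) * maximalFunction r g x := by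
      rw [add_mul]
      gcongr
      exact hbM x hx
    by_cases hxu : x ∈ ⋃ a ∈ u, closedBall a (5 * ρ a)
    · obtain ⟨a, ha, hxa⟩ := mem_iUnion₂.1 hxu
      refine Or.inr ⟨a, ha, hxa, ?_⟩
      have h := hloc g hg hgc Ω b hΩb a (ρ a) (hρ a ha).1.le (hρ a ha).2 x hxa
      rw [add_assoc] at h
      rw [show 3 * (5 * ρ a) = 15 * ρ a by ring]
      exact h.trans (by gcongr)
    -- Outside the stopping balls the density is small at all scales, so the inequality is used with
    -- `y = x` and `ρ = 0`.
    · have h := hloc g hg hgc Ω b hΩb x 0 le_rfl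
        (fun R hR => hgood x hxu R (by simpa using hR)) x (by simp)
      rw [maxModulatedMaximal_indicator_point, zero_add] at h
      exact Or.inl (h.trans hadd)

/-- Iterating the decomposition gives geometric decay on balls. -/
theorem exists_volume_le_two_inv_pow (hn : 0 < n) (hq : 1 ≤ q) (hqr : q⁻¹ + r⁻¹ ≤ 1)
    (hT : IsCalderonZygmund q T K) (hφ : ∀ α, Measurable (φ α)) {p : ℝ} (hp : 0 < p)
    (hpr : ENNReal.ofReal p ≤ r) {B : ℝ≥0}
    (hB : ∀ f : E n → ℂ, MemLp f (ENNReal.ofReal p) volume → HasCompactSupport f →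
      weakNorm p (maxModulated T φ f) ≤ B * eLpNorm f (ENNReal.ofReal p) volume) :
    ∃ C : ℝ≥0∞, C ≠ ∞ ∧ ∀ (k : ℕ) (z : E n) (ρ₀ : ℝ), 0 < ρ₀ → ∀ g : E n → ℂ,
      MemLp g ∞ volume → (∀ u ∉ closedBall z (3 * ρ₀), g u = 0) →
      volume {x ∈ closedBall z ρ₀ |
        k * (C * maximalFunction r g x) < maxModulatedMaximal K φ g x} ≤
          2⁻¹ ^ k * volume (closedBall z ρ₀) := by
  obtain ⟨C, hC, hdec⟩ := exists_stopping_decomposition hn hq hqr hT hφ hp hpr hB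
  refine ⟨C, hC, fun k => ?_⟩
  induction k with
  | zero =>
    intro z ρ₀ _ g _ _
    rw [pow_zero, one_mul]
    exact measure_mono fun x hx => hx.1
  | succ k ih =>
    intro z ρ₀ hρ₀ g hg hgz
    obtain ⟨u, ρ, hu, hρ, hsum, hx⟩ := hdec z ρ₀ hρ₀ g hg hgz
    set F : E n → Set (E n) := fun a => {x ∈ closedBall a (ρ a) |
      k * (C * maximalFunction r ((closedBall a (3 * ρ a)).indicator g) x) <
        maxModulatedMaximal K φ ((closedBall a (3 * ρ a)).indicator g) x} with hF
    have hsub : {x ∈ closedBall z ρ₀ | ((k + 1 : ℕ) : ℝ≥0∞) * (C * maximalFunction r g x) <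
        maxModulatedMaximal K φ g x} ⊆ ⋃ a ∈ u, F a := by
      rintro x ⟨hxz, hlt⟩
      push_cast at hlt
      rw [add_mul, one_mul] at hlt
      rcases hx x hxz with h | ⟨a, ha, hxa, h⟩
      · exact absurd (h.trans le_add_self) (not_le.2 hlt)
      · refine mem_iUnion₂.2 ⟨a, ha, hxa, ?_⟩
        -- One of the `k + 1` copies of `C M_r g` pays for the error term; the other `k` dominate
        -- those of the restricted function.
        have h1 := lt_of_add_lt_add_right (hlt.trans_le h)
        refine lt_of_le_of_lt ?_ h1
        gcongr
        exact maximalFunction_mono r (norm_indicator_le_norm_self g) x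
    calc volume {x ∈ closedBall z ρ₀ | ((k + 1 : ℕ) : ℝ≥0∞) * (C * maximalFunction r g x) <
          maxModulatedMaximal K φ g x}
        ≤ ∑' a : u, volume (F a) := (measure_mono hsub).trans (measure_biUnion_le volume hu F)
      _ ≤ ∑' a : u, 2⁻¹ ^ k * volume (closedBall (a : E n) (ρ a)) :=
        ENNReal.tsum_le_tsum fun a => ih a (ρ a) (hρ a a.2) _
          (hg.indicator measurableSet_closedBall) fun v hv => indicator_of_notMem hv g
      _ ≤ 2⁻¹ ^ k * (2⁻¹ * volume (closedBall z ρ₀)) := by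
        rw [ENNReal.tsum_mul_left]
        gcongr
      _ = _ := by ring

/-! ### From geometric to exponential decay -/

/-- The floor loses at most one factor `1/2`, whence the constant `2`. -/
theorem two_inv_pow_floor_le (c t : ℝ) :
    (2⁻¹ : ℝ≥0∞) ^ ⌊t / c⌋₊ ≤ ENNReal.ofReal (2 * Real.exp (-(Real.log 2 / c) * t)) := by
  have h2 : (2⁻¹ : ℝ≥0∞) = ENNReal.ofReal 2⁻¹ := by
    rw [ENNReal.ofReal_inv_of_pos two_pos, ENNReal.ofReal_ofNat]
  rw [h2, ← ENNReal.ofReal_pow (by norm_num)]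
  refine ENNReal.ofReal_le_ofReal ?_
  have hlog : 0 < Real.log 2 := Real.log_pos one_lt_two
  have hfl := (Nat.lt_floor_add_one (t / c)).le
  calc (2⁻¹ : ℝ) ^ ⌊t / c⌋₊ = Real.exp (-(Real.log 2 * ⌊t / c⌋₊)) := by
        rw [Real.exp_neg, Real.exp_mul, Real.exp_log two_pos, Real.rpow_natCast, inv_pow]
    _ ≤ Real.exp (Real.log 2 + -(Real.log 2 / c) * t) := by
        apply Real.exp_le_exp.2
        have h : Real.log 2 / c * t = Real.log 2 * (t / c) := by ring
        nlinarith
    _ = _ := by rw [Real.exp_add, Real.exp_log two_pos]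

end ModulatedCZ

open ModulatedCZ in
theorem theorem2p4 {n : ℕ} (hn : 0 < n) {q r : ℝ≥0∞} (hq : 1 ≤ q) (hr : 1 < r)
    (hqr : q⁻¹ + r⁻¹ ≤ 1)
    (T : (ModulatedCZ.E n → ℂ) → ModulatedCZ.E n → ℂ)
    (K : ModulatedCZ.E n → ModulatedCZ.E n → ℂ)
    (hT : ModulatedCZ.IsCalderonZygmund q T K)
    {A : Type*} (φ : A → ModulatedCZ.E n → ℝ) (hφ : ∀ α, Measurable (φ α))
    (ψ : ℝ → ℝ≥0) (hψ : ModulatedCZ.APrioriBound T φ ψ) :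
    ∃ a c : ℝ, 0 < a ∧ 0 < c ∧
      ∀ (z : ModulatedCZ.E n) (s : ℝ), 0 < s →
      ∀ f : ModulatedCZ.E n → ℂ, MemLp f ∞ volume → tsupport f ⊆ ModulatedCZ.cube z s →
      ∀ t : ℝ, 0 < t →
        volume {x ∈ ModulatedCZ.cube z s |
            ENNReal.ofReal t * ModulatedCZ.maximalFunction r f x <
              ModulatedCZ.maxModulatedMaximal K φ f x} ≤
          ENNReal.ofReal (c * Real.exp (-a * t)) * volume (ModulatedCZ.cube z s) := by
  have hn' : (0 : ℝ) < n := by exact_mod_cast hn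
  obtain ⟨-, B, hB⟩ := hψ
  -- The a priori bound needs `1 < p ≤ 2`, the comparison with `M_r` needs `p ≤ r`; capping at `2`
  -- also covers `r = ∞`.
  set p : ℝ := (min r 2).toReal with hpdef
  have hmin : min r 2 ≠ ∞ := (min_le_right r 2).trans_lt ENNReal.ofNat_lt_top |>.ne
  have hp1 : 1 < p := by
    rw [hpdef, ← ENNReal.toReal_one]
    exact (ENNReal.toReal_lt_toReal ENNReal.one_ne_top hmin).2 (lt_min hr (by norm_num))
  have hp2 : p ≤ 2 := by
    have h := ENNReal.toReal_mono ENNReal.ofNat_ne_top (min_le_right r 2)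
    simpa using h
  have hpr : ENNReal.ofReal p ≤ r := by
    rw [hpdef, ENNReal.ofReal_toReal hmin]
    exact min_le_left r 2
  obtain ⟨C, hC, hdecay⟩ := exists_volume_le_two_inv_pow (B := B * ψ (p / (p - 1))) hn hq hqr hT hφ
    (one_pos.trans hp1) hpr (fun f hf hc => by
      rw [ENNReal.coe_mul]
      exact hB p hp1 hp2 f hf hc)
  -- The added `1` permits division when `C = 0`.
  set c₀ : ℝ := C.toReal + 1 with hc₀
  have hc₀pos : 0 < c₀ := by positivity
  -- The factor `2` comes from the floor, `n^n` from replacing `Q` by the ball of radius `ns/2`,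
  -- which contains it.
  refine ⟨Real.log 2 / c₀, 2 * (n : ℝ) ^ n, div_pos (Real.log_pos one_lt_two) hc₀pos,
    by positivity, fun z s hs f hf hfs t ht => ?_⟩
  set k : ℕ := ⌊t / c₀⌋₊ with hk
  have hkt : (k : ℝ≥0∞) * C ≤ ENNReal.ofReal t := by
    have h1 : (k : ℝ) * c₀ ≤ t := (le_div_iff₀ hc₀pos).1 (Nat.floor_le (by positivity))
    calc (k : ℝ≥0∞) * C ≤ ENNReal.ofReal k * ENNReal.ofReal c₀ := by
          rw [ENNReal.ofReal_natCast]
          gcongr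
          rw [← ENNReal.ofReal_toReal hC]
          exact ENNReal.ofReal_le_ofReal (by linarith)
      _ = ENNReal.ofReal (k * c₀) := (ENNReal.ofReal_mul (by positivity)).symm
      _ ≤ ENNReal.ofReal t := ENNReal.ofReal_le_ofReal h1
  have hρ : 0 < n * s / 2 := by positivity
  have hQ := cube_subset_closedBall z hs.le
  have hf0 : ∀ u ∉ Metric.closedBall z (3 * (n * s / 2)), f u = 0 := fun u hu =>
    image_eq_zero_of_notMem_tsupport fun h =>
      hu (Metric.closedBall_subset_closedBall (by linarith) (hQ (hfs h)))
  have hvol : volume (Metric.closedBall z (n * s / 2)) ≤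
      ENNReal.ofReal ((n : ℝ) ^ n) * volume (cube z s) := by
    rw [show n * s / 2 = n * (s / 2) by ring, volume_closedBall_mul z z hn'.le (by positivity)]
    gcongr
    convert! closedBall_subset_cube z (s / 2) using 2
    ring
  calc volume {x ∈ cube z s |
        ENNReal.ofReal t * maximalFunction r f x < maxModulatedMaximal K φ f x}
      ≤ volume {x ∈ Metric.closedBall z (n * s / 2) |
        k * (C * maximalFunction r f x) < maxModulatedMaximal K φ f x} := by
        refine measure_mono fun x hx => ⟨hQ hx.1, lt_of_le_of_lt ?_ hx.2⟩
        rw [← mul_assoc]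
        gcongr
    _ ≤ 2⁻¹ ^ k * volume (Metric.closedBall z (n * s / 2)) := hdecay k z _ hρ f hf hf0
    _ ≤ ENNReal.ofReal (2 * Real.exp (-(Real.log 2 / c₀) * t)) *
        (ENNReal.ofReal ((n : ℝ) ^ n) * volume (cube z s)) := by
        gcongr
        exact two_inv_pow_floor_le c₀ t
    _ = _ := by
        rw [← mul_assoc, ← ENNReal.ofReal_mul (by positivity)]
        congr 2
        ring
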